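/- Let $n,d,\sigma$ be integers with $1\le\sigma\le d$, let $\varrho\ge 0$, and write $X\sim\mathcal{SG}(L^2)$ if $\mathbb E\exp(t(X-\mathbb E X))\le\exp(t^2L^2/2)$ for all $t\in\mathbb R$. Let $M\in\mathbb R^{n\times d}$ be a random matrix with i.i.d. entries that are $\mathcal{SG}(1)$, centered and of variance $1$; let $\epsilon\in\mathbb R^n$ be a random vector, independent of $M$, with i.i.d. centered entries $\epsilon_i\sim\mathcal{SG}(\varrho^2)$; let $z^*=(a,0_{d-\sigma})$ with $a\in\{\pm1\}^\sigma$ (deterministic), and let $b=Mz^*+\epsilon$ and $A=(-b\ \ M)\in\mathbb R^{n\times(1+d)}$. Consider the semidefinite program (SILS-SDP) $$\min_W\ \tfrac1n\operatorname{tr}(A^\top A W)\quad\text{s.t.}\quad W\succeq0,\ W_{11}=1,\ \operatorname{tr}(W_x)=\sigma,\ 1_d^\top|W_x|1_d\le\sigma^2,\ \operatorname{diag}(W_x)\le 1_d,$$ over symmetric real $(1+d)\times(1+d)$ matrices $W$, where $W_x$ is $W$ without its first row and column and $|W_x|$ is the entrywise absolute value. We say that it recovers $x\in\{0,\pm1\}^d$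 if its unique optimal solution is $\binom1x\binom1x^\top$. Theorem. There are absolute constants $C,K>0$ (not depending on $n,d,\sigma,\varrho,a$ or on the distributions of $M$ and $\epsilon$) such that, whenever $$n\ \ge\ C(\sigma^2+\varrho^2)\log d,$$ (SILS-SDP) recovers $z^*$ with probability at least $1-K/d-K\exp(-\sigma)$. -/

import Mathlib

open MeasureTheory ProbabilityTheory
open scoped NNReal

/-- The real random variable `X` is sub-Gaussian with variance proxy `v = L ^ 2`, written
`X ∼ SG(L ^ 2)`: it is integrable and `𝔼 exp (t (X - 𝔼 X)) ≤ exp (t ^ 2 * L ^ 2 / 2)` for every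
real `t` (all these exponential moments being finite). -/
def IsSG {Ω : Type*} [MeasurableSpace Ω] (X : Ω → ℝ) (v : ℝ≥0) (μ : Measure Ω) : Prop :=
  Integrable X μ ∧ HasSubgaussianMGF (fun ω => X ω - ∫ ω', X ω' ∂μ) v μ

/-- The random variables `X i` are independent and identically distributed. -/
def IsIID {Ω ι : Type*} [MeasurableSpace Ω] (X : ι → Ω → ℝ) (μ : Measure Ω) : Prop :=
  iIndepFun X μ ∧ ∀ i j, IdentDistrib (X i) (X j) μ μ

/-- The `n × (1 + d)` matrix `A = (-b  M)`. -/
def augMatrix {n d : ℕ} (M : Matrix (Fin n) (Fin d) ℝ) (b : Fin n → ℝ) :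
    Matrix (Fin n) (Fin (d + 1)) ℝ :=
  Matrix.of fun i => Fin.cons (-b i) (M i)

/-- `W_x`: the matrix `W` without its first row and column. -/
def dropFirst {d : ℕ} (W : Matrix (Fin (d + 1)) (Fin (d + 1)) ℝ) : Matrix (Fin d) (Fin d) ℝ :=
  W.submatrix Fin.succ Fin.succ

/-- The feasible region of the semidefinite relaxation. -/
structure SDPFeasible {d : ℕ} (σ : ℕ) (W : Matrix (Fin (d + 1)) (Fin (d + 1)) ℝ) : Prop where
  posSemidef : W.PosSemidef
  corner : W 0 0 = 1
  trace : (dropFirst W).trace = σ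
  l1 : ∑ i, ∑ j, |dropFirst W i j| ≤ (σ : ℝ) ^ 2
  diag : ∀ i, dropFirst W i i ≤ 1

/-- The objective `(1 / n) tr (Aᵀ A W)` of the semidefinite relaxation. -/
noncomputable def sdpObjective {n d : ℕ} (M : Matrix (Fin n) (Fin d) ℝ) (b : Fin n → ℝ)
    (W : Matrix (Fin (d + 1)) (Fin (d + 1)) ℝ) : ℝ :=
  1 / (n : ℝ) * ((augMatrix M b).transpose * augMatrix M b * W).trace

/-- `W` is an optimal solution of the semidefinite relaxation. -/
def SDPOptimal {n d : ℕ} (M : Matrix (Fin n) (Fin d) ℝ) (b : Fin n → ℝ) (σ : ℕ)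
    (W : Matrix (Fin (d + 1)) (Fin (d + 1)) ℝ) : Prop :=
  SDPFeasible σ W ∧ ∀ W', SDPFeasible σ W' → sdpObjective M b W ≤ sdpObjective M b W'

/-- The rank-one matrix `(1, x) (1, x)ᵀ`. -/
def rankOneLift {d : ℕ} (x : Fin d → ℝ) : Matrix (Fin (d + 1)) (Fin (d + 1)) ℝ :=
  Matrix.vecMulVec (Fin.cons 1 x) (Fin.cons 1 x)

/-- The semidefinite relaxation with data `(M, b, σ)` recovers `x`: the vector `x` has entries in
`{0, 1, -1}`, and `(1, x) (1, x)ᵀ` is optimal and is the only optimal solution. -/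
def SDPRecovers {n d : ℕ} (M : Matrix (Fin n) (Fin d) ℝ) (b : Fin n → ℝ) (σ : ℕ)
    (x : Fin d → ℝ) : Prop :=
  (∀ i, x i = 0 ∨ x i = 1 ∨ x i = -1) ∧
    ∀ W, SDPOptimal M b σ W ↔ W = rankOneLift x

/-- The vector `(a, 0)` of length `d`, for `a` of length `σ ≤ d`. -/
def padZero {σ : ℕ} (d : ℕ) (a : Fin σ → ℝ) : Fin d → ℝ :=
  fun j => if h : (j : ℕ) < σ then a ⟨j, h⟩ else 0

/-- The matrix of realizations at `ω` of the random entries `M i j`. -/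
def realize {Ω : Type*} {n d : ℕ} (M : Fin n → Fin d → Ω → ℝ) (ω : Ω) :
    Matrix (Fin n) (Fin d) ℝ :=
  Matrix.of fun i j => M i j ω

/-- The assumptions on the random input matrix `M` and the noise `ε`: the entries of `M` are
i.i.d. `SG(1)`, centered and of unit variance (so that the rows of `M` have covariance matrix
`I_d`); the entries of `ε` are i.i.d. `SG(ϱ ^ 2)` and centered; `M` and `ε` are independent. -/
structure LowCoherenceModel {Ω : Type*} [MeasurableSpace Ω] (μ : Measure Ω) {n d : ℕ}
    (M : Fin n → Fin d → Ω → ℝ) (ε : Fin n → Ω → ℝ) (ϱ : ℝ≥0) : Prop where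
  measurable_entry : ∀ i j, Measurable (M i j)
  iid_entry : IsIID (fun p : Fin n × Fin d => M p.1 p.2) μ
  sg_entry : ∀ i j, IsSG (M i j) 1 μ
  mean_entry : ∀ i j, ∫ ω, M i j ω ∂μ = 0
  variance_entry : ∀ i j, variance (M i j) μ = 1
  measurable_noise : ∀ i, Measurable (ε i)
  iid_noise : IsIID ε μ
  sg_noise : ∀ i, IsSG (ε i) (ϱ ^ 2) μ
  mean_noise : ∀ i, ∫ ω, ε i ω ∂μ = 0
  indep : IndepFun (fun ω (p : Fin n × Fin d) => M p.1 p.2 ω) (fun ω i => ε i ω) μ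

/-! Write x for the planted vector, w for `firstRow W`, D for `liftResidual x W`, and δ = σ - ⟨x,
w⟩. The objective is a quadratic form in the rows of (-b M), and substituting b = Mx + e turns it
into (1/n)(‖e‖² + 2⟨Mᵀe, x - w⟩ + ⟨MᵀM, D⟩), while the lift of x has value ‖e‖²/n.

For every feasible W the scalar δ controls everything. D is positive semidefinite with trace 2δ, so
δ ≥ 0, and the ℓ¹ constraint yields ‖x - w‖₁ ≤ 2δ (`sum_abs_sub_firstRow_le`) and ‖D‖₁ ≤ 6σδ
(`sum_abs_liftResidual_le`). If the columns of M have squared norm at least n/2, pairwise inner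
products at most n/(24σ), and inner products with e at most n/16, then the diagonal of MᵀM gains nδ,
while the off-diagonal part and the noise cost at most nδ/4 each. The gap is therefore at least δ/2
(`sdpObjective_sub_ge`), and δ = 0 forces W to be the lift (`eq_rankOneLift`).

The three conditions hold with high probability by Chernoff bounds: a Bernstein inequality for inner
products of independent sub-Gaussian vectors (`measureReal_abs_sum_mul_ge_le`) and a lower tail for
squared norms (`measureReal_sum_sq_le_le`). Each event fails with probability O(d⁻³), and there are
O(d²) of them. -/

/-- The first row of `W` without its corner. -/
def firstRow {d : ℕ} (W : Matrix (Fin (d + 1)) (Fin (d + 1)) ℝ) (i : Fin d) : ℝ := W 0 i.succ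

/-- The matrix `(-x  I) W (-x  I)ᵀ`, for `W` symmetric with `W 0 0 = 1`. -/
def liftResidual {d : ℕ} (x : Fin d → ℝ) (W : Matrix (Fin (d + 1)) (Fin (d + 1)) ℝ)
    (i j : Fin d) : ℝ :=
  dropFirst W i j - x i * firstRow W j - firstRow W i * x j + x i * x j

/-! ### Quadratic forms of `W` and expansion of the objective -/

section Deterministic

variable {n d : ℕ} {W : Matrix (Fin (d + 1)) (Fin (d + 1)) ℝ}

lemma sum_sum_succ_of_symm (hs : W.IsSymm) (h1 : W 0 0 = 1) (c : ℝ) (v : Fin d → ℝ) :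
    ∑ a, ∑ b, (Fin.cons c v : Fin (d + 1) → ℝ) a * (Fin.cons c v : Fin (d + 1) → ℝ) b * W a b =
      c ^ 2 + 2 * c * ∑ i, v i * firstRow W i + ∑ i, ∑ j, v i * v j * dropFirst W i j := by
  have h (i : Fin d) : W i.succ 0 = W 0 i.succ := hs.apply _ _
  simp only [Fin.sum_univ_succ, Fin.cons_zero, Fin.cons_succ, h1, h, Finset.sum_add_distrib,
    firstRow, dropFirst, Matrix.submatrix_apply, Finset.mul_sum]
  have e (i : Fin d) : v i * c * W 0 i.succ = c * v i * W 0 i.succ := by ring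
  have e' (i : Fin d) : 2 * c * (v i * W 0 i.succ) = c * v i * W 0 i.succ + c * v i * W 0 i.succ := by
    ring
  simp only [e, e', Finset.sum_add_distrib]
  ring

lemma quadForm_nonneg (hW : W.PosSemidef) (h1 : W 0 0 = 1) (c : ℝ) (v : Fin d → ℝ) :
    0 ≤ c ^ 2 + 2 * c * ∑ i, v i * firstRow W i + ∑ i, ∑ j, v i * v j * dropFirst W i j := by
  have hs : W.IsSymm := by simpa [Matrix.IsHermitian, Matrix.IsSymm] using hW.isHermitian
  rw [← sum_sum_succ_of_symm hs h1]
  have := hW.dotProduct_mulVec_nonneg (Fin.cons c v)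
  simp only [dotProduct, Matrix.mulVec, Finset.mul_sum, Pi.star_apply, star_trivial] at this
  refine this.trans_eq (Finset.sum_congr rfl fun a _ => Finset.sum_congr rfl fun b _ => ?_)
  ring

lemma sum_sum_mul_liftResidual (x v : Fin d → ℝ) :
    ∑ i, ∑ j, v i * v j * liftResidual x W i j =
      (∑ i, v i * x i) ^ 2 - 2 * (∑ i, v i * x i) * ∑ i, v i * firstRow W i
        + ∑ i, ∑ j, v i * v j * dropFirst W i j := by
  have h (f g : Fin d → ℝ) :
      (∑ i, v i * f i) * ∑ j, v j * g j = ∑ i, ∑ j, v i * v j * (f i * g j) := by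
    rw [Finset.sum_mul_sum]
    exact Finset.sum_congr rfl fun i _ => Finset.sum_congr rfl fun j _ => by ring
  have e : (∑ i, v i * x i) ^ 2 - 2 * (∑ i, v i * x i) * ∑ i, v i * firstRow W i =
      (∑ i, v i * x i) * (∑ i, v i * x i) - (∑ i, v i * x i) * (∑ i, v i * firstRow W i)
        - (∑ i, v i * firstRow W i) * (∑ i, v i * x i) := by ring
  rw [e, h, h, h]
  simp only [← Finset.sum_sub_distrib, ← Finset.sum_add_distrib, liftResidual]
  exact Finset.sum_congr rfl fun i _ => Finset.sum_congr rfl fun j _ => by ring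

/-- This is the form of `W` at the vector (-⟨v, x⟩, v). -/
lemma sum_sum_mul_liftResidual_nonneg (hW : W.PosSemidef) (h1 : W 0 0 = 1) (x v : Fin d → ℝ) :
    0 ≤ ∑ i, ∑ j, v i * v j * liftResidual x W i j := by
  rw [sum_sum_mul_liftResidual]
  refine (quadForm_nonneg hW h1 (-∑ i, v i * x i) v).trans_eq ?_
  ring

lemma liftResidual_self_nonneg (hW : W.PosSemidef) (h1 : W 0 0 = 1) (x : Fin d → ℝ) (i : Fin d) :
    0 ≤ liftResidual x W i i := by
  simpa [Pi.single_apply] using sum_sum_mul_liftResidual_nonneg hW h1 x (Pi.single i 1)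

lemma dropFirst_symm (hW : W.PosSemidef) (i j : Fin d) : dropFirst W i j = dropFirst W j i := by
  have hs : W.IsSymm := by simpa [Matrix.IsHermitian, Matrix.IsSymm] using hW.isHermitian
  exact (hs.apply _ _).symm

lemma liftResidual_symm (hW : W.PosSemidef) (x : Fin d → ℝ) (i j : Fin d) :
    liftResidual x W i j = liftResidual x W j i := by
  simp only [liftResidual, dropFirst_symm hW i j]
  ring

/-- Positivity of the form at the two vectors eᵢ ± eⱼ. -/
lemma abs_liftResidual_le (hW : W.PosSemidef) (h1 : W 0 0 = 1) (x : Fin d → ℝ) (i j : Fin d) :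
    |liftResidual x W i j| ≤ (liftResidual x W i i + liftResidual x W j j) / 2 := by
  have key (s : ℝ) := sum_sum_mul_liftResidual_nonneg hW h1 x (Pi.single i 1 + Pi.single j s)
  simp only [Pi.add_apply, Pi.single_apply, add_mul, mul_add, Finset.sum_add_distrib, ite_mul,
    mul_ite, zero_mul, mul_zero, Finset.sum_ite_eq', Finset.mem_univ, if_true, one_mul, mul_one,
    liftResidual_symm hW x j i] at key
  have hp := key 1
  have hm := key (-1)
  rw [abs_le]
  constructor <;> linarith

lemma firstRow_sq_le (hW : W.PosSemidef) (h1 : W 0 0 = 1) (i : Fin d) :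
    firstRow W i ^ 2 ≤ dropFirst W i i := by
  have := quadForm_nonneg hW h1 (-firstRow W i) (Pi.single i 1)
  simp [Pi.single_apply] at this
  linarith

/-- The trace is the sum over k of the form of `W` at the k-th row of (-b M), whose corner is -(Mx)ₖ
- eₖ. Separating the noise from -(Mx)ₖ leaves exactly the form of D at the k-th row of M, plus terms
in eₖ. -/
lemma sdpObjective_eq_of_symm (M : Matrix (Fin n) (Fin d) ℝ) (x : Fin d → ℝ) (e : Fin n → ℝ)
    (hs : W.IsSymm) (h1 : W 0 0 = 1) :
    sdpObjective M (fun i => M.mulVec x i + e i) W = 1 / (n : ℝ) * (∑ k, e k ^ 2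
      + 2 * ∑ j, (∑ k, M k j * e k) * (x j - firstRow W j)
      + ∑ i, ∑ j, (∑ k, M k i * M k j) * liftResidual x W i j) := by
  rw [sdpObjective]
  congr 1
  have hrow (k : Fin n) : ∑ a, ∑ b, augMatrix M (fun i => M.mulVec x i + e i) k a *
        augMatrix M (fun i => M.mulVec x i + e i) k b * W a b =
      e k ^ 2 + 2 * ∑ j, M k j * e k * (x j - firstRow W j)
        + ∑ i, ∑ j, M k i * M k j * liftResidual x W i j := by
    have := sum_sum_succ_of_symm hs h1 (-(M.mulVec x k + e k)) (M k)
    simp only [augMatrix, Matrix.of_apply]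
    rw [this, sum_sum_mul_liftResidual]
    have e1 : ∑ j, M k j * e k * (x j - firstRow W j) =
        e k * ∑ j, M k j * x j - e k * ∑ j, M k j * firstRow W j := by
      rw [Finset.mul_sum, Finset.mul_sum, ← Finset.sum_sub_distrib]
      exact Finset.sum_congr rfl fun i _ => by ring
    rw [e1]
    simp only [Matrix.mulVec, dotProduct]
    ring
  have htr : ((augMatrix M (fun i => M.mulVec x i + e i)).transpose *
      augMatrix M (fun i => M.mulVec x i + e i) * W).trace =
      ∑ k, ∑ a, ∑ b, augMatrix M (fun i => M.mulVec x i + e i) k a *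
        augMatrix M (fun i => M.mulVec x i + e i) k b * W a b := by
    simp only [Matrix.trace, Matrix.diag_apply, Matrix.mul_apply, Matrix.transpose_apply,
      Finset.sum_mul]
    rw [Finset.sum_comm (s := (Finset.univ : Finset (Fin n)))]
    refine Finset.sum_congr rfl fun a _ => ?_
    rw [Finset.sum_comm (s := (Finset.univ : Finset (Fin n)))]
    refine Finset.sum_congr rfl fun b _ => Finset.sum_congr rfl fun k _ => ?_
    rw [hs.apply]
  rw [htr, Finset.sum_congr rfl fun k _ => hrow k, Finset.sum_add_distrib,
    Finset.sum_add_distrib, ← Finset.mul_sum]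
  congr 1
  · congr 2
    rw [Finset.sum_comm]
    simp only [Finset.sum_mul]
  · rw [Finset.sum_comm]
    refine Finset.sum_congr rfl fun i _ => ?_
    rw [Finset.sum_comm]
    simp only [Finset.sum_mul]

lemma sum_abs_eq_of_sum_sq_eq {x : Fin d → ℝ} {σ : ℕ} (hx : ∀ i, x i = 0 ∨ x i = 1 ∨ x i = -1)
    (hσ : ∑ i, x i ^ 2 = σ) : ∑ i, |x i| = σ := by
  rw [← hσ]
  refine Finset.sum_congr rfl fun i _ => ?_
  rcases hx i with h | h | h <;> simp [h]

lemma sdpFeasible_rankOneLift {x : Fin d → ℝ} {σ : ℕ} (hx : ∀ i, x i = 0 ∨ x i = 1 ∨ x i = -1)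
    (hσ : ∑ i, x i ^ 2 = σ) : SDPFeasible σ (rankOneLift x) where
  posSemidef := by
    have := Matrix.posSemidef_vecMulVec_self_star (Fin.cons 1 x : Fin (d + 1) → ℝ)
    simpa [rankOneLift] using this
  corner := by simp [rankOneLift, Matrix.vecMulVec_apply]
  trace := by
    simp [rankOneLift, dropFirst, Matrix.trace, Matrix.vecMulVec_apply, ← hσ, sq]
  l1 := by
    simp only [rankOneLift, dropFirst, Matrix.submatrix_apply, Matrix.vecMulVec_apply,
      Fin.cons_succ, abs_mul]
    rw [← Finset.sum_mul_sum, sum_abs_eq_of_sum_sq_eq hx hσ, sq]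
  diag i := by
    simp only [rankOneLift, dropFirst, Matrix.submatrix_apply, Matrix.vecMulVec_apply,
      Fin.cons_succ]
    rcases hx i with h | h | h <;> simp [h]

lemma sdpObjective_rankOneLift (M : Matrix (Fin n) (Fin d) ℝ) (x : Fin d → ℝ) (e : Fin n → ℝ) :
    sdpObjective M (fun i => M.mulVec x i + e i) (rankOneLift x) =
      1 / (n : ℝ) * ∑ k, e k ^ 2 := by
  have hs : (rankOneLift x).IsSymm := by
    ext i j
    simp [rankOneLift, Matrix.vecMulVec_apply, mul_comm]
  rw [sdpObjective_eq_of_symm M x e hs (by simp [rankOneLift, Matrix.vecMulVec_apply])]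
  have hD (i j : Fin d) : liftResidual x (rankOneLift x) i j = 0 := by
    simp [liftResidual, rankOneLift, dropFirst, firstRow, Matrix.vecMulVec_apply]
  have hf (j : Fin d) : x j - firstRow (rankOneLift x) j = 0 := by
    simp [rankOneLift, firstRow, Matrix.vecMulVec_apply]
  simp [hD, hf]

/-! ### Geometry of the feasible region around the lift -/

variable {σ : ℕ} {x : Fin d → ℝ}

lemma sum_liftResidual_self (hW : SDPFeasible σ W) (hσ : ∑ i, x i ^ 2 = σ) :
    ∑ i, liftResidual x W i i = 2 * (σ - ∑ i, x i * firstRow W i) := by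
  have ht : ∑ i, dropFirst W i i = σ := hW.trace
  have (i : Fin d) : liftResidual x W i i =
      dropFirst W i i + x i ^ 2 - 2 * (x i * firstRow W i) := by
    simp only [liftResidual]; ring
  simp only [this, Finset.sum_sub_distrib, Finset.sum_add_distrib, ht, hσ, ← Finset.mul_sum]
  ring

lemma sum_mul_firstRow_le (hW : SDPFeasible σ W) (hσ : ∑ i, x i ^ 2 = σ) :
    ∑ i, x i * firstRow W i ≤ σ := by
  have h := sum_liftResidual_self hW hσ
  have h0 : 0 ≤ ∑ i, liftResidual x W i i :=
    Finset.sum_nonneg fun i _ => liftResidual_self_nonneg hW.posSemidef hW.corner x i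
  linarith

lemma abs_firstRow_le_one (hW : SDPFeasible σ W) (i : Fin d) : |firstRow W i| ≤ 1 := by
  have h := (firstRow_sq_le hW.posSemidef hW.corner i).trans (hW.diag i)
  exact (sq_le_one_iff_abs_le_one _).1 h

/-- Off the support of `x`, the first row of a feasible matrix has small `ℓ¹` norm. -/
lemma sum_abs_firstRow_compl_le (hW : SDPFeasible σ W) (h1σ : 1 ≤ σ)
    (hx : ∀ i, x i = 0 ∨ x i = 1 ∨ x i = -1) :
    ∑ i, (1 - x i ^ 2) * |firstRow W i| ≤ σ - ∑ i, x i * firstRow W i := by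
  -- The vector y = x + s extends x by the signs of w off the support. Its entries are bounded by 1,
  -- so the ℓ¹ constraint gives yᵀ W_x y ≤ σ².
  set s : Fin d → ℝ := fun i => (1 - x i ^ 2) * SignType.sign (firstRow W i) with hs
  have hsign (r : ℝ) : |(SignType.sign r : ℝ)| ≤ 1 := by
    rcases lt_trichotomy r 0 with h | h | h <;> simp [h]
  have hy (i : Fin d) : |x i + s i| ≤ 1 := by
    rcases hx i with h | h | h <;> simp [hs, h, hsign]
  have hyw : ∑ i, (x i + s i) * firstRow W i =
      ∑ i, x i * firstRow W i + ∑ i, (1 - x i ^ 2) * |firstRow W i| := by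
    rw [← Finset.sum_add_distrib]
    refine Finset.sum_congr rfl fun i _ => ?_
    rw [← sign_mul_self (firstRow W i)]
    simp only [hs]
    ring
  have hq : ∑ i, ∑ j, (x i + s i) * (x j + s j) * dropFirst W i j ≤ (σ : ℝ) ^ 2 := by
    refine le_trans (Finset.sum_le_sum fun i _ => Finset.sum_le_sum fun j _ => ?_) hW.l1
    calc _ ≤ |(x i + s i) * (x j + s j) * dropFirst W i j| := le_abs_self _
      _ = |x i + s i| * |x j + s j| * |dropFirst W i j| := by rw [abs_mul, abs_mul]
      _ ≤ 1 * 1 * |dropFirst W i j| := by gcongr <;> exact hy _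
      _ = _ := by ring
  -- At (-σ, y) the form is at most 2σ² - 2σ⟨y, w⟩, hence ⟨y, w⟩ ≤ σ.
  have h := quadForm_nonneg hW.posSemidef hW.corner (-(σ : ℝ)) fun i => x i + s i
  rw [hyw] at h
  have hσ0 : (0 : ℝ) < σ := by exact_mod_cast h1σ
  have : 0 ≤ (2 * σ : ℝ) * (σ - ∑ i, x i * firstRow W i
      - ∑ i, (1 - x i ^ 2) * |firstRow W i|) := by linarith
  linarith [nonneg_of_mul_nonneg_right this (by positivity)]

lemma sum_abs_sub_firstRow_le (hW : SDPFeasible σ W) (h1σ : 1 ≤ σ)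
    (hx : ∀ i, x i = 0 ∨ x i = 1 ∨ x i = -1) (hσ : ∑ i, x i ^ 2 = σ) :
    ∑ i, |x i - firstRow W i| ≤ 2 * (σ - ∑ i, x i * firstRow W i) := by
  have h (i : Fin d) : |x i - firstRow W i| =
      (x i ^ 2 - x i * firstRow W i) + (1 - x i ^ 2) * |firstRow W i| := by
    have hw := abs_le.1 (abs_firstRow_le_one hW i)
    rcases hx i with h | h | h
    · simp [h]
    · simp only [h]
      rw [abs_of_nonneg (by linarith)]
      ring
    · simp only [h]
      rw [abs_of_nonpos (by linarith)]
      ring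
  have := sum_abs_firstRow_compl_le hW h1σ hx
  simp only [h, Finset.sum_add_distrib, Finset.sum_sub_distrib, hσ]
  linarith

/-- Let S be the support of x. On S × S, positivity bounds the entries of D by its diagonal, for a
total of σ tr D = 2σδ. Elsewhere D differs from W_x only by entries of w outside S, which cost σδ
for each of the two mixed blocks. The mass of |W_x| outside S × S is at most σ² - xᵀ W_x x ≤ σ² - (σ
- δ)² ≤ 2σδ. -/
lemma sum_abs_liftResidual_le (hW : SDPFeasible σ W) (h1σ : 1 ≤ σ)
    (hx : ∀ i, x i = 0 ∨ x i = 1 ∨ x i = -1) (hσ : ∑ i, x i ^ 2 = σ) :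
    ∑ i, ∑ j, |liftResidual x W i j| ≤ 6 * σ * (σ - ∑ i, x i * firstRow W i) := by
  set δ : ℝ := σ - ∑ i, x i * firstRow W i with hδ
  have hsq (i : Fin d) : x i ^ 2 = |x i| := by rcases hx i with h | h | h <;> simp [h]
  have habs := sum_abs_eq_of_sum_sq_eq hx hσ
  have ht := sum_abs_firstRow_compl_le hW h1σ hx
  have hdiag (i : Fin d) := liftResidual_self_nonneg hW.posSemidef hW.corner x i
  -- The second term is nonnegative on S × S and equals |W_x| off it, so one inequality covers all
  -- blocks.
  have hpt (i j : Fin d) : |liftResidual x W i j| ≤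
      |x i| * |x j| * ((liftResidual x W i i + liftResidual x W j j) / 2)
      + (|dropFirst W i j| - x i * x j * dropFirst W i j)
      + |x i| * ((1 - x j ^ 2) * |firstRow W j|) + (1 - x i ^ 2) * |firstRow W i| * |x j| := by
    have hP (r : ℝ) : 0 ≤ |r| - r := sub_nonneg.2 (le_abs_self _)
    have hP' (r : ℝ) : 0 ≤ |r| + r := by linarith [neg_abs_le r]
    have hD := abs_liftResidual_le hW.posSemidef hW.corner x i j
    have b1 := hP (dropFirst W i j)
    have b2 := hP' (dropFirst W i j)
    have c1 := abs_sub (dropFirst W i j) (firstRow W j)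
    have c2 := abs_add_le (dropFirst W i j) (firstRow W j)
    have c3 := abs_sub (dropFirst W i j) (firstRow W i)
    have c4 := abs_add_le (dropFirst W i j) (firstRow W i)
    rcases hx i with h | h | h <;> rcases hx j with h' | h' | h' <;>
      simp [liftResidual, h, h'] at hD ⊢ <;> linarith
  -- Schur complement inequality: xᵀ W_x x ≥ ⟨x, w⟩².
  have hPP : (σ - δ) ^ 2 ≤ ∑ i, ∑ j, x i * x j * dropFirst W i j := by
    have := quadForm_nonneg hW.posSemidef hW.corner (-∑ i, x i * firstRow W i) x
    have e : σ - δ = ∑ i, x i * firstRow W i := by rw [hδ]; ring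
    rw [e]
    linarith
  have hSS : ∑ i, ∑ j, |x i| * |x j| * ((liftResidual x W i i + liftResidual x W j j) / 2) ≤
      2 * σ * δ := by
    have e : ∑ i, ∑ j, |x i| * |x j| * ((liftResidual x W i i + liftResidual x W j j) / 2) =
        σ * ∑ i, |x i| * liftResidual x W i i := by
      have (i j : Fin d) : |x i| * |x j| * ((liftResidual x W i i + liftResidual x W j j) / 2) =
          (|x i| * liftResidual x W i i) * |x j| / 2 + |x i| * (|x j| * liftResidual x W j j) / 2 := by
        ring
      simp only [this, Finset.sum_add_distrib, ← Finset.sum_div, ← Finset.sum_mul_sum, habs]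
      ring
    have hle : ∑ i, |x i| * liftResidual x W i i ≤ ∑ i, liftResidual x W i i := by
      refine Finset.sum_le_sum fun i _ => mul_le_of_le_one_left (hdiag i) ?_
      rcases hx i with h | h | h <;> simp [h]
    rw [e]
    rw [sum_liftResidual_self hW hσ] at hle
    calc _ ≤ σ * (2 * δ) := by gcongr
      _ = _ := by ring
  have hx1 : ∑ i, ∑ j, |x i| * ((1 - x j ^ 2) * |firstRow W j|) ≤ σ * δ := by
    rw [← Finset.sum_mul_sum, habs]
    gcongr
  have hx2 : ∑ i, ∑ j, (1 - x i ^ 2) * |firstRow W i| * |x j| ≤ σ * δ := by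
    rw [← Finset.sum_mul_sum, habs, mul_comm]
    gcongr
  have hl1 := hW.l1
  calc _ ≤ _ := Finset.sum_le_sum fun i _ => Finset.sum_le_sum fun j _ => hpt i j
    _ ≤ 6 * σ * δ := by
      simp only [Finset.sum_add_distrib, Finset.sum_sub_distrib]
      nlinarith [sq_nonneg δ]

/-- Quantitative optimality of the lift of `x`, for a design with nearly orthogonal columns that
are nearly orthogonal to the noise. -/
lemma sdpObjective_sub_ge (hW : SDPFeasible σ W) (h1σ : 1 ≤ σ) (hn : 0 < n)
    (hx : ∀ i, x i = 0 ∨ x i = 1 ∨ x i = -1) (hσ : ∑ i, x i ^ 2 = σ)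
    (M : Matrix (Fin n) (Fin d) ℝ) (e : Fin n → ℝ)
    (hdiag : ∀ j, (n : ℝ) / 2 ≤ ∑ k, M k j ^ 2)
    (hoff : ∀ i j, i ≠ j → |∑ k, M k i * M k j| ≤ n / (24 * σ))
    (hnoise : ∀ j, |∑ k, M k j * e k| ≤ n / 16) :
    sdpObjective M (fun i => M.mulVec x i + e i) (rankOneLift x)
        + (σ - ∑ i, x i * firstRow W i) / 2 ≤
      sdpObjective M (fun i => M.mulVec x i + e i) W := by
  have hs : W.IsSymm := by
    simpa [Matrix.IsHermitian, Matrix.IsSymm] using hW.posSemidef.isHermitian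
  rw [sdpObjective_rankOneLift, sdpObjective_eq_of_symm M x e hs hW.corner]
  have hn' : (0 : ℝ) < n := by exact_mod_cast hn
  have hσ' : (0 : ℝ) < σ := by exact_mod_cast h1σ
  have htr := sum_liftResidual_self hW hσ
  have hl1 := sum_abs_liftResidual_le hW h1σ hx hσ
  have hw := sum_abs_sub_firstRow_le hW h1σ hx hσ
  have hdn (i : Fin d) := liftResidual_self_nonneg hW.posSemidef hW.corner x i
  set δ : ℝ := σ - ∑ i, x i * firstRow W i with hδ
  have h1 : -(n / 8 * δ) ≤ ∑ j, (∑ k, M k j * e k) * (x j - firstRow W j) := by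
    have : ∑ j, -(n / 16 * |x j - firstRow W j|) ≤
        ∑ j, (∑ k, M k j * e k) * (x j - firstRow W j) := by
      refine Finset.sum_le_sum fun j _ => ?_
      refine (neg_le_neg ?_).trans (neg_abs_le _)
      rw [abs_mul]
      gcongr
      exact hnoise j
    rw [Finset.sum_neg_distrib, ← Finset.mul_sum] at this
    have : (n : ℝ) / 16 * ∑ j, |x j - firstRow W j| ≤ n / 16 * (2 * δ) := by gcongr
    linarith
  -- The diagonal contributes (n/2) tr D = nδ. The off-diagonal loss is at most n/(24σ) · 6σδ, with
  -- the diagonal of |D| included in the sum for simplicity.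
  have h2 : n * δ - n / 4 * δ ≤ ∑ i, ∑ j, (∑ k, M k i * M k j) * liftResidual x W i j := by
    have hpt (i j : Fin d) : (if i = j then n / 2 * liftResidual x W i i else 0)
        - n / (24 * σ) * |liftResidual x W i j| ≤
        (∑ k, M k i * M k j) * liftResidual x W i j := by
      split_ifs with hij
      · subst hij
        have : n / 2 * liftResidual x W i i ≤ (∑ k, M k i * M k i) * liftResidual x W i i := by
          gcongr
          · exact hdn i
          · simpa [sq] using hdiag i
        have h0 : 0 ≤ n / (24 * σ) * |liftResidual x W i i| := by positivity
        linarith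
      · rw [zero_sub]
        refine (neg_le_neg ?_).trans (neg_abs_le _)
        rw [abs_mul]
        gcongr
        exact hoff i j hij
    have := Finset.sum_le_sum fun i (_ : i ∈ Finset.univ) =>
      Finset.sum_le_sum fun j (_ : j ∈ Finset.univ) => hpt i j
    simp only [Finset.sum_sub_distrib, Finset.sum_ite_eq, Finset.mem_univ, if_true,
      ← Finset.mul_sum, htr] at this
    have hb : n / (24 * σ) * ∑ i, ∑ j, |liftResidual x W i j| ≤ n / (24 * σ) * (6 * σ * δ) := by
      gcongr
    have he : n / (24 * σ) * (6 * σ * δ) = n / 4 * δ := by field_simp; ring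
    linarith
  have : 1 / (n : ℝ) * ∑ k, e k ^ 2 + δ / 2 = 1 / (n : ℝ) * (∑ k, e k ^ 2 + n * δ / 2) := by
    field_simp
  rw [this]
  exact mul_le_mul_of_nonneg_left (by linarith) (by positivity)

lemma eq_rankOneLift (hW : SDPFeasible σ W) (h1σ : 1 ≤ σ)
    (hx : ∀ i, x i = 0 ∨ x i = 1 ∨ x i = -1) (hσ : ∑ i, x i ^ 2 = σ)
    (h : ∑ i, x i * firstRow W i = σ) : W = rankOneLift x := by
  have hl1 := sum_abs_liftResidual_le hW h1σ hx hσ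
  have hw := sum_abs_sub_firstRow_le hW h1σ hx hσ
  rw [h, sub_self, mul_zero] at hl1 hw
  have hw0 (i : Fin d) : firstRow W i = x i := by
    have := (Finset.single_le_sum (f := fun i => |x i - firstRow W i|)
      (fun i _ => abs_nonneg _) (Finset.mem_univ i)).trans hw
    exact (sub_eq_zero.1 (abs_nonpos_iff.1 this)).symm
  have hD (i j : Fin d) : liftResidual x W i j = 0 := by
    have h1 := (Finset.single_le_sum (f := fun i => ∑ j, |liftResidual x W i j|)
      (fun i _ => Finset.sum_nonneg fun j _ => abs_nonneg _) (Finset.mem_univ i)).trans hl1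
    have h2 := (Finset.single_le_sum (f := fun j => |liftResidual x W i j|)
      (fun j _ => abs_nonneg _) (Finset.mem_univ j)).trans h1
    exact abs_nonpos_iff.1 h2
  have hs : W.IsSymm := by
    simpa [Matrix.IsHermitian, Matrix.IsSymm] using hW.posSemidef.isHermitian
  ext i j
  refine Fin.cases ?_ (fun i => ?_) i <;> refine Fin.cases ?_ (fun j => ?_) j
  · simp [rankOneLift, Matrix.vecMulVec_apply, hW.corner]
  · simpa [rankOneLift, Matrix.vecMulVec_apply] using! hw0 j
  · rw [hs.apply]
    simpa [rankOneLift, Matrix.vecMulVec_apply] using! hw0 i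
  · have := hD i j
    simp only [liftResidual, hw0, dropFirst, Matrix.submatrix_apply] at this
    simp only [rankOneLift, Matrix.vecMulVec_apply, Fin.cons_succ]
    linarith

lemma sdpRecovers_of_nearly_orthogonal (h1σ : 1 ≤ σ) (hn : 0 < n)
    (hx : ∀ i, x i = 0 ∨ x i = 1 ∨ x i = -1) (hσ : ∑ i, x i ^ 2 = σ)
    (M : Matrix (Fin n) (Fin d) ℝ) (e : Fin n → ℝ)
    (hdiag : ∀ j, (n : ℝ) / 2 ≤ ∑ k, M k j ^ 2)
    (hoff : ∀ i j, i ≠ j → |∑ k, M k i * M k j| ≤ n / (24 * σ))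
    (hnoise : ∀ j, |∑ k, M k j * e k| ≤ n / 16) :
    SDPRecovers M (fun i => M.mulVec x i + e i) σ x := by
  have hge (W) (hW : SDPFeasible σ W) :=
    sdpObjective_sub_ge hW h1σ hn hx hσ M e hdiag hoff hnoise
  have hfeas := sdpFeasible_rankOneLift hx hσ
  refine ⟨hx, fun W => ⟨fun ⟨hW, hopt⟩ => ?_, ?_⟩⟩
  · refine eq_rankOneLift hW h1σ hx hσ (le_antisymm (sum_mul_firstRow_le hW hσ) ?_)
    linarith [hge W hW, hopt _ hfeas]
  · rintro rfl
    refine ⟨hfeas, fun W' hW' => ?_⟩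
    linarith [hge W' hW', sum_mul_firstRow_le hW' hσ]

end Deterministic

/-! ### Exponential moments and tail bounds for sub-Gaussian vectors -/

section Tails

open Real

variable {Ω : Type*} [MeasurableSpace Ω] {μ : Measure Ω}

lemma ProbabilityTheory.HasSubgaussianMGF.lintegral_exp_le {X : Ω → ℝ} {c : ℝ≥0} (h : HasSubgaussianMGF X c μ)
    (t : ℝ) : ∫⁻ ω, ENNReal.ofReal (exp (t * X ω)) ∂μ ≤ ENNReal.ofReal (exp (c * t ^ 2 / 2)) := by
  rw [← ofReal_integral_eq_lintegral_ofReal (h.integrable_exp_mul t)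
    (ae_of_all _ fun _ => (exp_pos _).le)]
  exact ENNReal.ofReal_le_ofReal (h.mgf_le t)

lemma lintegral_exp_mul_gaussianReal (t : ℝ) :
    ∫⁻ x, ENNReal.ofReal (exp (t * x)) ∂(gaussianReal 0 1) =
      ENNReal.ofReal (exp (t ^ 2 / 2)) := by
  rw [← ofReal_integral_eq_lintegral_ofReal (integrable_exp_mul_gaussianReal t)
    (ae_of_all _ fun _ => (exp_pos _).le)]
  have := congrFun (mgf_fun_id_gaussianReal (μ := 0) (v := 1)) t
  rw [mgf] at this
  rw [this]
  simp

lemma lintegral_exp_mul_sq_gaussianReal_le {s : ℝ} (h0 : 0 ≤ s) (h1 : s ≤ 1 / 4) :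
    ∫⁻ x, ENNReal.ofReal (exp (s * x ^ 2)) ∂(gaussianReal 0 1) ≤
      ENNReal.ofReal (exp (2 * s)) := by
  have hb : 0 < 1 / 2 - s := by linarith
  rw [gaussianReal_of_var_ne_zero _ one_ne_zero,
    lintegral_withDensity_eq_lintegral_mul _ (measurable_gaussianPDF _ _) (by fun_prop)]
  have e (x : ℝ) : (gaussianPDF 0 1 * fun x => ENNReal.ofReal (exp (s * x ^ 2))) x =
      ENNReal.ofReal ((√(2 * π))⁻¹ * exp (-(1 / 2 - s) * x ^ 2)) := by
    rw [Pi.mul_apply, gaussianPDF, ← ENNReal.ofReal_mul (gaussianPDFReal_nonneg _ _ _),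
      gaussianPDFReal, mul_assoc, ← exp_add]
    congr 3
    · simp
    · simp; ring
  simp_rw [e]
  rw [← ofReal_integral_eq_lintegral_ofReal ((integrable_exp_neg_mul_sq hb).const_mul _)
    (ae_of_all _ fun _ => by positivity), integral_const_mul, integral_gaussian]
  refine ENNReal.ofReal_le_ofReal ?_
  rw [← sqrt_inv, ← sqrt_mul (by positivity)]
  refine sqrt_le_iff.2 ⟨(exp_pos _).le, ?_⟩
  rw [← exp_nat_mul]
  have h2 : (2 * π)⁻¹ * (π / (1 / 2 - s)) = 1 / (1 - 2 * s) := by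
    have : 1 - 2 * s ≠ 0 := by linarith
    field_simp
  -- After squaring, the claim is 1 ≤ (1 - 2s) exp (4s). It follows from (1 - 2s)(1 + 4s) ≥ 1, which
  -- is where s ≤ 1/4 enters.
  rw [h2, div_le_iff₀ (by linarith)]
  have h3 := add_one_le_exp (((2 : ℕ) : ℝ) * (2 * s))
  push_cast at h3 ⊢
  nlinarith

/-- The square of a sub-Gaussian variable has exponential moments of small order. -/
lemma lintegral_exp_mul_sq_le {X : Ω → ℝ} [SFinite μ] (h : HasSubgaussianMGF X 1 μ)
    (hX : Measurable X) {s : ℝ} (h0 : 0 ≤ s) (h1 : s ≤ 1 / 4) :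
    ∫⁻ ω, ENNReal.ofReal (exp (s * X ω ^ 2)) ∂μ ≤ ENNReal.ofReal (exp (2 * s)) := by
  have hsq : √(2 * s) ^ 2 = 2 * s := sq_sqrt (by positivity)
  -- Linearize the square with an auxiliary standard Gaussian g: exp (s X²) = 𝔼_g exp (√(2s) X g).
  -- Tonelli then lets the sub-Gaussian bound on X apply at fixed g.
  calc ∫⁻ ω, ENNReal.ofReal (exp (s * X ω ^ 2)) ∂μ
      = ∫⁻ ω, ∫⁻ g, ENNReal.ofReal (exp (√(2 * s) * X ω * g)) ∂(gaussianReal 0 1) ∂μ := by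
        refine lintegral_congr fun ω => ?_
        rw [lintegral_exp_mul_gaussianReal, mul_pow, hsq]
        congr 2
        ring
    _ = ∫⁻ g, ∫⁻ ω, ENNReal.ofReal (exp (√(2 * s) * X ω * g)) ∂μ ∂(gaussianReal 0 1) :=
        lintegral_lintegral_swap (by fun_prop)
    _ ≤ ∫⁻ g, ENNReal.ofReal (exp (s * g ^ 2)) ∂(gaussianReal 0 1) := by
        refine lintegral_mono fun g => ?_
        have := h.lintegral_exp_le (√(2 * s) * g)
        have e : ((1 : ℝ≥0) : ℝ) * (√(2 * s) * g) ^ 2 / 2 = s * g ^ 2 := by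
          rw [mul_pow, hsq, NNReal.coe_one]
          ring
        rw [e] at this
        refine le_of_eq_of_le (lintegral_congr fun ω => ?_) this
        congr 2
        ring
    _ ≤ _ := lintegral_exp_mul_sq_gaussianReal_le h0 h1

lemma lintegral_exp_sum_mul_le {ι : Type*} [Fintype ι] {Y : ι → Ω → ℝ} (hY : iIndepFun Y μ)
    {c : ℝ≥0} (hs : ∀ i, HasSubgaussianMGF (Y i) c μ) (x : ι → ℝ) :
    ∫⁻ ω, ENNReal.ofReal (exp (∑ i, x i * Y i ω)) ∂μ ≤
      ENNReal.ofReal (exp (c / 2 * ∑ i, x i ^ 2)) := by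
  have hsx (i : ι) : HasSubgaussianMGF (fun ω => x i * Y i ω) (Real.nnabs (x i) ^ 2 * c) μ := by
    refine ⟨fun t => ?_, fun t => ?_⟩
    · simpa only [mul_assoc] using (hs i).integrable_exp_mul (t * x i)
    · rw [mgf_const_mul]
      refine ((hs i).mgf_le (x i * t)).trans_eq ?_
      simp only [NNReal.coe_mul, NNReal.coe_pow, Real.coe_nnabs, sq_abs]
      congr 1
      ring
  have h := HasSubgaussianMGF.sum_of_iIndepFun (s := Finset.univ)
    (hY.comp (fun i r => x i * r) fun i => by fun_prop) fun i _ => hsx i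
  refine (h.lintegral_exp_le 1).trans_eq' ?_ |>.trans_eq ?_
  · simp
  · simp only [NNReal.coe_sum, NNReal.coe_mul, NNReal.coe_pow, Real.coe_nnabs, sq_abs,
      ← Finset.sum_mul]
    congr 2
    ring

lemma lintegral_exp_mul_sum_sq_le {ι : Type*} [Fintype ι] {X : ι → Ω → ℝ} (hX : iIndepFun X μ)
    (hm : ∀ i, Measurable (X i)) (hs : ∀ i, HasSubgaussianMGF (X i) 1 μ) {s : ℝ} (h0 : 0 ≤ s)
    (h1 : s ≤ 1 / 4) :
    ∫⁻ ω, ENNReal.ofReal (exp (s * ∑ i, X i ω ^ 2)) ∂μ ≤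
      ENNReal.ofReal (exp (Fintype.card ι * (2 * s))) := by
  have := hX.isProbabilityMeasure
  have e (ω : Ω) : ENNReal.ofReal (exp (s * ∑ i, X i ω ^ 2)) =
      ∏ i, ENNReal.ofReal (exp (s * X i ω ^ 2)) := by
    rw [Finset.mul_sum, exp_sum, ENNReal.ofReal_prod_of_nonneg fun i _ => (exp_pos _).le]
  simp_rw [e]
  rw [lintegral_prod_eq_prod_lintegral_of_indepFun Finset.univ
    (fun i ω => ENNReal.ofReal (exp (s * X i ω ^ 2)))
    (hX.comp (fun _ r => ENNReal.ofReal (exp (s * r ^ 2))) fun i => by fun_prop)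
    (fun i => by fun_prop)]
  refine (Finset.prod_le_prod' fun i _ => lintegral_exp_mul_sq_le (hs i) (hm i) h0 h1).trans_eq ?_
  rw [Finset.prod_const, ← ENNReal.ofReal_pow (exp_pos _).le, ← exp_nat_mul, Finset.card_univ]

/-- Exponential moments of the inner product of two independent sub-Gaussian vectors. -/
lemma lintegral_exp_mul_sum_mul_le {ι : Type*} [Fintype ι] {X Y : ι → Ω → ℝ}
    (hX : iIndepFun X μ) (hY : iIndepFun Y μ)
    (hXY : IndepFun (fun ω i => X i ω) (fun ω i => Y i ω) μ)
    (hmX : ∀ i, Measurable (X i)) (hmY : ∀ i, Measurable (Y i))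
    (hsX : ∀ i, HasSubgaussianMGF (X i) 1 μ) {c : ℝ≥0} (hsY : ∀ i, HasSubgaussianMGF (Y i) c μ)
    {t : ℝ} (ht : c * t ^ 2 ≤ 1 / 2) :
    ∫⁻ ω, ENNReal.ofReal (exp (t * ∑ i, X i ω * Y i ω)) ∂μ ≤
      ENNReal.ofReal (exp (Fintype.card ι * (c * t ^ 2))) := by
  have := hX.isProbabilityMeasure
  have hvX : Measurable fun ω i => X i ω := measurable_pi_lambda _ hmX
  have hvY : Measurable fun ω i => Y i ω := measurable_pi_lambda _ hmY
  have hF : Measurable fun p : (ι → ℝ) × (ι → ℝ) =>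
      ENNReal.ofReal (exp (t * ∑ i, p.1 i * p.2 i)) := by fun_prop
  have hlaw := (indepFun_iff_map_prod_eq_prod_map_map hvX.aemeasurable hvY.aemeasurable).1 hXY
  calc ∫⁻ ω, ENNReal.ofReal (exp (t * ∑ i, X i ω * Y i ω)) ∂μ
      = ∫⁻ p, ENNReal.ofReal (exp (t * ∑ i, p.1 i * p.2 i))
          ∂(μ.map fun ω => ((fun i => X i ω), fun i => Y i ω)) := by
        rw [lintegral_map hF (hvX.prodMk hvY)]
    _ = ∫⁻ ω, ∫⁻ ω', ENNReal.ofReal (exp (t * ∑ i, X i ω * Y i ω')) ∂μ ∂μ := by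
        rw [hlaw, lintegral_prod _ hF.aemeasurable, lintegral_map hF.lintegral_prod_right' hvX]
        refine lintegral_congr fun ω => ?_
        rw [lintegral_map (by fun_prop) hvY]
    -- With X frozen the sum is linear in Y, so its moment is governed by the squared norm of X.
    _ ≤ ∫⁻ ω, ENNReal.ofReal (exp (c * t ^ 2 / 2 * ∑ i, X i ω ^ 2)) ∂μ := by
        refine lintegral_mono fun ω => ?_
        have h := lintegral_exp_sum_mul_le hY hsY fun i => t * X i ω
        simp only [mul_pow, ← Finset.mul_sum, mul_assoc] at h
        refine h.trans_eq ?_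
        congr 2
        ring
    _ ≤ _ := by
        refine (lintegral_exp_mul_sum_sq_le hX hmX hsX (by positivity) (by linarith)).trans_eq ?_
        congr 3
        ring

lemma measureReal_le_exp_of_lintegral_exp_le [IsFiniteMeasure μ] {Z : Ω → ℝ} (hZ : Measurable Z)
    {a b : ℝ} (h : ∫⁻ ω, ENNReal.ofReal (exp (Z ω)) ∂μ ≤ ENNReal.ofReal (exp b)) :
    μ.real {ω | a ≤ Z ω} ≤ exp (b - a) := by
  have hM := mul_meas_ge_le_lintegral (μ := μ) (f := fun ω => ENNReal.ofReal (exp (Z ω)))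
    (by fun_prop) (ENNReal.ofReal (exp a))
  have hset : {ω | ENNReal.ofReal (exp a) ≤ ENNReal.ofReal (exp (Z ω))} = {ω | a ≤ Z ω} := by
    ext ω
    simp only [Set.mem_ofPred_eq]
    rw [ENNReal.ofReal_le_ofReal_iff (exp_pos _).le, exp_le_exp]
  rw [hset] at hM
  have h2 := ENNReal.toReal_mono ENNReal.ofReal_ne_top (hM.trans h)
  rw [ENNReal.toReal_mul, ENNReal.toReal_ofReal (exp_pos _).le,
    ENNReal.toReal_ofReal (exp_pos _).le] at h2
  rw [exp_sub, le_div_iff₀ (exp_pos _), mul_comm]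
  exact h2

/-- A one-sided Bernstein bound for the inner product of two independent sub-Gaussian vectors. -/
lemma measureReal_sum_mul_ge_le {ι : Type*} [Fintype ι] {X Y : ι → Ω → ℝ}
    (hX : iIndepFun X μ) (hY : iIndepFun Y μ)
    (hXY : IndepFun (fun ω i => X i ω) (fun ω i => Y i ω) μ)
    (hmX : ∀ i, Measurable (X i)) (hmY : ∀ i, Measurable (Y i))
    (hsX : ∀ i, HasSubgaussianMGF (X i) 1 μ) {c : ℝ≥0} (hsY : ∀ i, HasSubgaussianMGF (Y i) c μ)
    (hc : 1 ≤ c) {s : ℝ} (hs0 : 0 ≤ s) (hs1 : s ≤ 1) :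
    μ.real {ω | Fintype.card ι * s ≤ ∑ i, X i ω * Y i ω} ≤
      exp (-(Fintype.card ι * s ^ 2 / (4 * c))) := by
  have := hX.isProbabilityMeasure
  have hc' : (1 : ℝ) ≤ c := by exact_mod_cast hc
  obtain rfl | hs := hs0.eq_or_lt
  · simp
  -- Minimizer of c t² - s t. The bounds 1 ≤ c and s ≤ 1 keep c t² = s²/(4c) in the admissible
  -- range.
  set t : ℝ := s / (2 * c) with ht
  have ht0 : 0 < t := by positivity
  have hct : c * t ^ 2 = s ^ 2 / (4 * c) := by
    rw [ht]; field_simp; ring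
  have hle : c * t ^ 2 ≤ 1 / 2 := by
    rw [hct, div_le_iff₀ (by positivity)]
    nlinarith
  have hZ : Measurable fun ω => t * ∑ i, X i ω * Y i ω := by fun_prop
  have h := measureReal_le_exp_of_lintegral_exp_le (a := t * (Fintype.card ι * s)) hZ
    (lintegral_exp_mul_sum_mul_le hX hY hXY hmX hmY hsX hsY hle)
  simp only [mul_le_mul_iff_right₀ ht0] at h
  refine h.trans_eq ?_
  congr 1
  rw [hct, ht]
  field_simp
  ring

lemma measureReal_abs_sum_mul_ge_le {ι : Type*} [Fintype ι] {X Y : ι → Ω → ℝ}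
    (hX : iIndepFun X μ) (hY : iIndepFun Y μ)
    (hXY : IndepFun (fun ω i => X i ω) (fun ω i => Y i ω) μ)
    (hmX : ∀ i, Measurable (X i)) (hmY : ∀ i, Measurable (Y i))
    (hsX : ∀ i, HasSubgaussianMGF (X i) 1 μ) {c : ℝ≥0} (hsY : ∀ i, HasSubgaussianMGF (Y i) c μ)
    (hc : 1 ≤ c) {s : ℝ} (hs0 : 0 ≤ s) (hs1 : s ≤ 1) :
    μ.real {ω | Fintype.card ι * s ≤ |∑ i, X i ω * Y i ω|} ≤
      2 * exp (-(Fintype.card ι * s ^ 2 / (4 * c))) := by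
  have := hX.isProbabilityMeasure
  have h1 := measureReal_sum_mul_ge_le hX hY hXY hmX hmY hsX hsY hc hs0 hs1
  have h2 := measureReal_sum_mul_ge_le (X := X) (Y := fun i => -Y i) hX
    (hY.comp (fun _ r => -r) fun _ => by fun_prop)
    (hXY.comp (φ := id) (ψ := fun v : ι → ℝ => fun i => -v i) measurable_id (by fun_prop)) hmX
    (fun i => (hmY i).neg) hsX (fun i => (hsY i).neg) hc hs0 hs1
  have hsub : {ω | Fintype.card ι * s ≤ |∑ i, X i ω * Y i ω|} ⊆
      {ω | Fintype.card ι * s ≤ ∑ i, X i ω * Y i ω} ∪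
        {ω | Fintype.card ι * s ≤ ∑ i, X i ω * (-Y i) ω} := by
    intro ω hω
    simpa [le_abs] using hω
  calc _ ≤ _ := measureReal_mono hsub
    _ ≤ _ := measureReal_union_le _ _
    _ ≤ _ := by linarith

lemma lintegral_exp_neg_mul_sq_le [IsProbabilityMeasure μ] {X : Ω → ℝ} (hX : Measurable X)
    (hs : HasSubgaussianMGF X 1 μ) (hvar : ∫ ω, X ω ^ 2 ∂μ = 1) {t : ℝ} (ht : 0 ≤ t) :
    ∫⁻ ω, ENNReal.ofReal (exp (-t * X ω ^ 2)) ∂μ ≤ ENNReal.ofReal (exp (-t + 32 * t ^ 2)) := by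
  have hi2 : Integrable (fun ω => X ω ^ 2) μ := (hs.memLp 2).integrable_sq
  have hi4 : Integrable (fun ω => X ω ^ 4) μ := by
    have := (hs.memLp 4).integrable_norm_pow (p := 4) (by norm_num)
    simpa [Even.pow_abs (show Even 4 by decide)] using this
  -- From y²/2 ≤ exp y at y = X²/4, one has X⁴ ≤ 32 exp (X²/4), with expectation at most 32 exp
  -- (1/2) ≤ 64.
  have h4 : ∫ ω, X ω ^ 4 ∂μ ≤ 64 := by
    have hexp := lintegral_exp_mul_sq_le hs hX (s := 1 / 4) (by norm_num) le_rfl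
    have hle : ENNReal.ofReal (∫ ω, X ω ^ 4 ∂μ) ≤ ENNReal.ofReal (32 * exp (2 * (1 / 4))) := by
      rw [ofReal_integral_eq_lintegral_ofReal hi4 (ae_of_all _ fun ω => by positivity),
        ENNReal.ofReal_mul (by norm_num)]
      refine le_trans ?_ (mul_le_mul_right hexp _)
      rw [← lintegral_const_mul _ (by fun_prop)]
      refine lintegral_mono fun ω => ?_
      rw [← ENNReal.ofReal_mul (by norm_num)]
      refine ENNReal.ofReal_le_ofReal ?_
      have := quadratic_le_exp_of_nonneg (x := 1 / 4 * X ω ^ 2) (by positivity)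
      nlinarith [sq_nonneg (X ω)]
    have h := (ENNReal.ofReal_le_ofReal_iff (by positivity)).1 hle
    have he : exp (2 * (1 / 4)) ≤ 2 := by
      have : exp (2 * (1 / 4)) ^ 2 ≤ 2 ^ 2 := by
        rw [← exp_nat_mul]
        norm_num
        linarith [exp_one_lt_d9]
      exact le_of_sq_le_sq this (by norm_num)
    linarith
  have hpt (ω : Ω) : exp (-t * X ω ^ 2) ≤ 1 - t * X ω ^ 2 + t ^ 2 / 2 * X ω ^ 4 := by
    have hy : 0 ≤ t * X ω ^ 2 := by positivity
    have h := quadratic_le_exp_of_nonneg hy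
    have h' : exp (-t * X ω ^ 2) * exp (t * X ω ^ 2) = 1 := by
      rw [← exp_add]; simp
    have e : t ^ 2 / 2 * X ω ^ 4 = (t * X ω ^ 2) ^ 2 / 2 := by ring
    rw [e]
    set y := t * X ω ^ 2
    have hpos := exp_pos (-t * X ω ^ 2)
    set E := exp (-t * X ω ^ 2)
    have h1 : E * (1 + y + y ^ 2 / 2) ≤ 1 := (mul_le_mul_of_nonneg_left h hpos.le).trans_eq h'
    -- The product equals 1 + y⁴/4.
    have h2 : 1 ≤ (1 - y + y ^ 2 / 2) * (1 + y + y ^ 2 / 2) := by nlinarith [sq_nonneg (y ^ 2)]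
    have h3 : 0 < 1 + y + y ^ 2 / 2 := by positivity
    exact le_of_mul_le_mul_right (h1.trans h2) h3
  have hi : Integrable (fun ω => 1 - t * X ω ^ 2 + t ^ 2 / 2 * X ω ^ 4) μ :=
    ((integrable_const _).sub (hi2.const_mul _)).add (hi4.const_mul _)
  calc ∫⁻ ω, ENNReal.ofReal (exp (-t * X ω ^ 2)) ∂μ
      ≤ ∫⁻ ω, ENNReal.ofReal (1 - t * X ω ^ 2 + t ^ 2 / 2 * X ω ^ 4) ∂μ :=
        lintegral_mono fun ω => ENNReal.ofReal_le_ofReal (hpt ω)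
    _ = ENNReal.ofReal (∫ ω, (1 - t * X ω ^ 2 + t ^ 2 / 2 * X ω ^ 4) ∂μ) :=
        (ofReal_integral_eq_lintegral_ofReal hi
          (ae_of_all _ fun ω => (exp_pos _).le.trans (hpt ω))).symm
    _ ≤ _ := by
        refine ENNReal.ofReal_le_ofReal ?_
        rw [integral_add (f := fun ω => 1 - t * X ω ^ 2)
            ((integrable_const _).sub (hi2.const_mul _)) (hi4.const_mul _),
          integral_sub (integrable_const _) (hi2.const_mul _), integral_const_mul,
          integral_const_mul, hvar]
        have := add_one_le_exp (-t + 32 * t ^ 2)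
        have h5 : t ^ 2 / 2 * ∫ ω, X ω ^ 4 ∂μ ≤ t ^ 2 / 2 * 64 := by gcongr
        simp only [integral_const, probReal_univ, smul_eq_mul]
        linarith

/-- A lower tail bound for the squared norm of a sub-Gaussian vector of unit variance. -/
lemma measureReal_sum_sq_le_le {ι : Type*} [Fintype ι] {X : ι → Ω → ℝ} (hX : iIndepFun X μ)
    (hm : ∀ i, Measurable (X i)) (hs : ∀ i, HasSubgaussianMGF (X i) 1 μ)
    (hvar : ∀ i, ∫ ω, X i ω ^ 2 ∂μ = 1) :
    μ.real {ω | ∑ i, X i ω ^ 2 ≤ Fintype.card ι / 2} ≤ exp (-(Fintype.card ι / 512)) := by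
  have := hX.isProbabilityMeasure
  have e (ω : Ω) : ENNReal.ofReal (exp (-(1 / 128) * ∑ i, X i ω ^ 2)) =
      ∏ i, ENNReal.ofReal (exp (-(1 / 128) * X i ω ^ 2)) := by
    rw [Finset.mul_sum, exp_sum, ENNReal.ofReal_prod_of_nonneg fun i _ => (exp_pos _).le]
  -- The parameter t = 1/128 minimizes -t/2 + 32 t², with value -1/512.
  have h : ∫⁻ ω, ENNReal.ofReal (exp (-(1 / 128) * ∑ i, X i ω ^ 2)) ∂μ ≤
      ENNReal.ofReal (exp (Fintype.card ι * (-(1 / 128) + 32 * (1 / 128) ^ 2))) := by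
    simp_rw [e]
    rw [lintegral_prod_eq_prod_lintegral_of_indepFun Finset.univ
      (fun i ω => ENNReal.ofReal (exp (-(1 / 128) * X i ω ^ 2)))
      (hX.comp (fun _ r => ENNReal.ofReal (exp (-(1 / 128) * r ^ 2))) fun i => by fun_prop)
      (fun i => by fun_prop)]
    refine (Finset.prod_le_prod' fun i _ => lintegral_exp_neg_mul_sq_le (hm i) (hs i) (hvar i)
      (by norm_num)).trans_eq ?_
    rw [Finset.prod_const, ← ENNReal.ofReal_pow (exp_pos _).le, ← exp_nat_mul, Finset.card_univ]
  have h2 := measureReal_le_exp_of_lintegral_exp_le (a := -(1 / 128) * (Fintype.card ι / 2))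
    (by fun_prop) h
  refine (measureReal_mono fun ω hω => ?_).trans (h2.trans_eq ?_)
  · simp only [Set.mem_ofPred_eq] at hω ⊢
    linarith
  · congr 1
    ring

end Tails

/-! ### Union bound for the random model -/

section Model

variable {Ω : Type*} [MeasurableSpace Ω] {μ : Measure Ω} {n d : ℕ} {M : Fin n → Fin d → Ω → ℝ}
  {ε : Fin n → Ω → ℝ} {ϱ : ℝ≥0}

namespace LowCoherenceModel

lemma hasSubgaussianMGF_entry (h : LowCoherenceModel μ M ε ϱ) (i : Fin n) (j : Fin d) :
    HasSubgaussianMGF (M i j) 1 μ := by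
  simpa [h.mean_entry] using (h.sg_entry i j).2

lemma hasSubgaussianMGF_noise (h : LowCoherenceModel μ M ε ϱ) (i : Fin n) :
    HasSubgaussianMGF (ε i) (ϱ ^ 2) μ := by
  simpa [h.mean_noise] using (h.sg_noise i).2

lemma iIndepFun_column (h : LowCoherenceModel μ M ε ϱ) (j : Fin d) :
    iIndepFun (fun i => M i j) μ :=
  h.iid_entry.1.precomp (g := fun i : Fin n => (i, j)) fun _ _ hab => (Prod.ext_iff.1 hab).1

lemma indepFun_columns (h : LowCoherenceModel μ M ε ϱ) {j k : Fin d} (hjk : j ≠ k) :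
    IndepFun (fun ω i => M i j ω) (fun ω i => M i k ω) μ := by
  classical
  let S (j : Fin d) : Finset (Fin n × Fin d) := Finset.univ.image fun i => (i, j)
  have hS (j : Fin d) (i : Fin n) : (i, j) ∈ S j :=
    Finset.mem_image_of_mem _ (Finset.mem_univ i)
  have hdisj : Disjoint (S j) (S k) := by
    rw [Finset.disjoint_left]
    simp only [S, Finset.mem_image, Finset.mem_univ, true_and]
    rintro _ ⟨i, rfl⟩ ⟨i', h'⟩
    exact hjk (Prod.ext_iff.1 h').2.symm
  exact (h.iid_entry.1.indepFun_finset (S j) (S k) hdisj fun p => h.measurable_entry p.1 p.2).comp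
    (φ := fun v i => v ⟨(i, j), hS j i⟩) (ψ := fun v i => v ⟨(i, k), hS k i⟩)
    (by fun_prop) (by fun_prop)

lemma indepFun_column_noise (h : LowCoherenceModel μ M ε ϱ) (j : Fin d) :
    IndepFun (fun ω i => M i j ω) (fun ω i => ε i ω) μ :=
  h.indep.comp (φ := fun v : Fin n × Fin d → ℝ => fun i => v (i, j)) (ψ := id) (by fun_prop) measurable_id

lemma integral_entry_sq (h : LowCoherenceModel μ M ε ϱ) (i : Fin n) (j : Fin d) :
    ∫ ω, M i j ω ^ 2 ∂μ = 1 := by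
  rw [← variance_of_integral_eq_zero (h.measurable_entry i j).aemeasurable (h.mean_entry i j),
    h.variance_entry]

end LowCoherenceModel

lemma sum_padZero_sq {σ : ℕ} (hσd : σ ≤ d) {a : Fin σ → ℝ} (ha : ∀ i, a i = 1 ∨ a i = -1) :
    ∑ i, padZero d a i ^ 2 = σ := by
  have h (i : Fin d) : padZero d a i ^ 2 = if (i : ℕ) < σ then 1 else 0 := by
    unfold padZero
    split_ifs with hi
    · rcases ha ⟨i, hi⟩ with h | h <;> simp [h]
    · simp
  simp only [h, Finset.sum_boole]
  rw [Fin.card_filter_val_lt, min_eq_right hσd]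

lemma padZero_eq {σ : ℕ} {a : Fin σ → ℝ} (ha : ∀ i, a i = 1 ∨ a i = -1) (i : Fin d) :
    padZero d a i = 0 ∨ padZero d a i = 1 ∨ padZero d a i = -1 := by
  unfold padZero
  split_ifs with hi
  · exact Or.inr (ha _)
  · exact Or.inl rfl

/-- The three terms are the failures of the norm, coherence and noise conditions. The rates come
from n s²/(4c), with s = 1/(24σ), c = 1 for pairs of columns and s = 1/16, c = max(1, ϱ²) for the
noise. -/
lemma measureReal_not_sdpRecovers_le [IsProbabilityMeasure μ] (h : LowCoherenceModel μ M ε ϱ)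
    {σ : ℕ} (h1σ : 1 ≤ σ) (hn : 0 < n) {x : Fin d → ℝ}
    (hx : ∀ i, x i = 0 ∨ x i = 1 ∨ x i = -1) (hσ : ∑ i, x i ^ 2 = σ) :
    μ.real {ω | ¬ SDPRecovers (realize M ω)
        (fun i => (realize M ω).mulVec x i + ε i ω) σ x} ≤
      d * Real.exp (-(n / 512)) + d ^ 2 * (2 * Real.exp (-(n / (2304 * σ ^ 2))))
        + d * (2 * Real.exp (-(n / (1024 * max 1 ((ϱ : ℝ) ^ 2))))) := by
  have hσ' : (1 : ℝ) ≤ σ := by exact_mod_cast h1σ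
  set A : Fin d → Set Ω := fun j => {ω | ∑ i, M i j ω ^ 2 ≤ n / 2} with hA
  set B : Fin d × Fin d → Set Ω := fun p => {ω | p.1 ≠ p.2 ∧
    n / (24 * σ) ≤ |∑ i, M i p.1 ω * M i p.2 ω|} with hB
  set D : Fin d → Set Ω := fun j => {ω | n / 16 ≤ |∑ i, M i j ω * ε i ω|} with hD
  have hAle (j : Fin d) : μ.real (A j) ≤ Real.exp (-(n / 512)) := by
    simpa using measureReal_sum_sq_le_le (h.iIndepFun_column j)
      (fun i => h.measurable_entry i j) (fun i => h.hasSubgaussianMGF_entry i j)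
      fun i => h.integral_entry_sq i j
  have hBle (p : Fin d × Fin d) :
      μ.real (B p) ≤ 2 * Real.exp (-(n / (2304 * σ ^ 2))) := by
    by_cases hp : p.1 = p.2
    · have : B p = ∅ := by simp [hB, hp]
      rw [this, measureReal_empty]
      positivity
    · have := measureReal_abs_sum_mul_ge_le (h.iIndepFun_column p.1) (h.iIndepFun_column p.2)
        (h.indepFun_columns hp) (fun i => h.measurable_entry i _)
        (fun i => h.measurable_entry i _) (fun i => h.hasSubgaussianMGF_entry i _)
        (fun i => h.hasSubgaussianMGF_entry i _) le_rfl (s := 1 / (24 * σ)) (by positivity)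
        (by rw [div_le_one (by positivity)]; linarith)
      rw [Fintype.card_fin] at this
      convert! this using 2
      · ext ω
        simp [hB, hp, div_eq_mul_inv]
      · congr 2
        simp only [NNReal.coe_one]
        field_simp
        norm_num
  have hDle (j : Fin d) :
      μ.real (D j) ≤ 2 * Real.exp (-(n / (1024 * max 1 ((ϱ : ℝ) ^ 2)))) := by
    -- The variance proxy is enlarged to at least 1, as the Bernstein bound requires.
    have hs (i : Fin n) : HasSubgaussianMGF (ε i) (max 1 (ϱ ^ 2)) μ := by
      have hi := h.hasSubgaussianMGF_noise i
      refine ⟨hi.integrable_exp_mul, fun t => (hi.mgf_le t).trans ?_⟩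
      gcongr
      exact le_max_right _ _
    have := measureReal_abs_sum_mul_ge_le (h.iIndepFun_column j) h.iid_noise.1
      (h.indepFun_column_noise j) (fun i => h.measurable_entry i _) h.measurable_noise
      (fun i => h.hasSubgaussianMGF_entry i _) hs (le_max_left _ _) (s := 1 / 16) (by norm_num)
      (by norm_num)
    rw [Fintype.card_fin] at this
    convert! this using 2
    · ext ω
      simp [hD, div_eq_mul_inv]
    · congr 2
      push_cast
      field_simp
      norm_num
  have hsub : {ω | ¬ SDPRecovers (realize M ω)
      (fun i => (realize M ω).mulVec x i + ε i ω) σ x} ⊆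
      ((⋃ j, A j) ∪ ⋃ p, B p) ∪ ⋃ j, D j := by
    intro ω hω
    by_contra hc
    simp only [Set.mem_union, Set.mem_iUnion, not_or, not_exists, hA, hB, hD, Set.mem_ofPred_eq,
      not_and, not_le] at hc
    exact hω (sdpRecovers_of_nearly_orthogonal h1σ hn hx hσ (realize M ω) (fun i => ε i ω)
      (fun j => (hc.1.1 j).le) (fun i j hij => (hc.1.2 (i, j) hij).le) fun j => (hc.2 j).le)
  refine (measureReal_mono hsub).trans ((measureReal_union_le _ _).trans
    (add_le_add ((measureReal_union_le _ _).trans (add_le_add ?_ ?_)) ?_))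
  · refine (measureReal_iUnion_fintype_le _).trans ((Finset.sum_le_sum fun j _ => hAle j).trans ?_)
    simp
  · refine (measureReal_iUnion_fintype_le _).trans ((Finset.sum_le_sum fun j _ => hBle j).trans ?_)
    simp [sq]
  · refine (measureReal_iUnion_fintype_le _).trans ((Finset.sum_le_sum fun j _ => hDle j).trans ?_)
    simp

end Model

/-! ### Choice of constants -/

theorem theorem5p7 :
    ∃ C K : ℝ, 0 < C ∧ 0 < K ∧
      ∀ (n d σ : ℕ) (ϱ : ℝ≥0) (a : Fin σ → ℝ)
        (Ω : Type*) [MeasurableSpace Ω] (μ : Measure Ω) [IsProbabilityMeasure μ]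
        (M : Fin n → Fin d → Ω → ℝ) (ε : Fin n → Ω → ℝ),
        1 ≤ σ → σ ≤ d → (∀ i, a i = 1 ∨ a i = -1) →
        LowCoherenceModel μ M ε ϱ →
        C * ((σ : ℝ) ^ 2 + (ϱ : ℝ) ^ 2) * Real.log d ≤ n →
        μ.real {ω | ¬ SDPRecovers (realize M ω)
            (fun i => (realize M ω).mulVec (padZero d a) i + ε i ω) σ (padZero d a)}
          ≤ K / d + K * Real.exp (-(σ : ℝ)) := by
  -- 6912 = 3 · 2304 makes every exponential at most d⁻³. The union bound then gives 3/d² + 2/d ≤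
  -- 5/d, and the term in exp (-σ) is slack.
  refine ⟨6912, 5, by norm_num, by norm_num, ?_⟩
  intro n d σ ϱ a Ω _ μ _ M ε h1σ hσd ha h hnC
  have hexp := Real.exp_pos (-(σ : ℝ))
  have hσ : (1 : ℝ) ≤ σ := by exact_mod_cast h1σ
  obtain rfl | hd2 : d = 1 ∨ 1 < d := by omega
  -- For d = 1 the logarithm vanishes and n may be 0, but the claimed bound already exceeds 1.
  · refine measureReal_le_one.trans ?_
    push_cast
    linarith
  have hd : (1 : ℝ) < d := by exact_mod_cast hd2
  have hlog : 0 < Real.log d := Real.log_pos hd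
  have hn' : (0 : ℝ) < n := lt_of_lt_of_le (by positivity) hnC
  have hn : 0 < n := by exact_mod_cast hn'
  have hcube {c : ℝ} (hc : 0 < c) (hcn : 3 * c * Real.log d ≤ n) :
      Real.exp (-(n / c)) ≤ ((d : ℝ) ^ 3)⁻¹ := by
    rw [Real.exp_neg]
    refine inv_anti₀ (by positivity) ?_
    rw [← Real.exp_log (show (0 : ℝ) < d by linarith), ← Real.exp_nat_mul, Real.exp_le_exp,
      le_div_iff₀ hc]
    push_cast
    linarith
  have hϱ : (0 : ℝ) ≤ (ϱ : ℝ) ^ 2 := by positivity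
  have hσ2 : (1 : ℝ) ≤ (σ : ℝ) ^ 2 := one_le_pow₀ hσ
  have key {c : ℝ} (hc : 3 * c ≤ 6912 * ((σ : ℝ) ^ 2 + (ϱ : ℝ) ^ 2)) :
      3 * c * Real.log d ≤ n := (mul_le_mul_of_nonneg_right hc hlog.le).trans hnC
  have e1 := hcube (c := 512) (by norm_num) (key (by linarith))
  have e2 := hcube (c := 2304 * (σ : ℝ) ^ 2) (by positivity) (key (by linarith))
  have e3 := hcube (c := 1024 * max 1 ((ϱ : ℝ) ^ 2)) (by positivity) (key (by
    have : max 1 ((ϱ : ℝ) ^ 2) ≤ (σ : ℝ) ^ 2 + (ϱ : ℝ) ^ 2 := max_le (by linarith) (by linarith)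
    linarith))
  refine (measureReal_not_sdpRecovers_le h h1σ hn (padZero_eq ha) (sum_padZero_sq hσd ha)).trans ?_
  calc _ ≤ d * ((d : ℝ) ^ 3)⁻¹ + d ^ 2 * (2 * ((d : ℝ) ^ 3)⁻¹) + d * (2 * ((d : ℝ) ^ 3)⁻¹) := by
        gcongr
    _ ≤ 5 / d := by
        have : d * ((d : ℝ) ^ 3)⁻¹ + d ^ 2 * (2 * ((d : ℝ) ^ 3)⁻¹) + d * (2 * ((d : ℝ) ^ 3)⁻¹) =
            (3 / d + 2) / d := by
          field_simp
          ring
        rw [this]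
        have : 3 / (d : ℝ) ≤ 3 := div_le_self (by norm_num) hd.le
        gcongr
        linarith
    _ ≤ _ := by linarith
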